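/- Let $q$ be a complex number with $|q|<1$. Write $(x;q)_n=\prod_{k=0}^{n-1}(1-xq^k)$ and $(x;q)_\infty=\prod_{k=0}^{\infty}(1-xq^k)$, and let $$B^{(2)}(q)=\sum_{n=0}^{\infty}\frac{q^{n}(-q;q^2)_n}{(q;q^2)_{n+1}}$$ be the second order mock theta function. Then $$B^{(2)}(q)=\frac{(-q;q^2)_\infty}{(q;q)_\infty^2}\sum_{n=0}^{\infty}\frac{(-1)^nq^{n^2+2n}}{1+q^{2n+1}}\sum_{j=-n}^{n}q^{-j(j+1)/2},$$ where both series over $n$ converge absolutely, the infinite products converge, and $(q;q)_\infty\neq 0$. (Since $n^2+2n-j(j+1)/2\ge 0$ for $|j|\le n$, with equality only for $n=0$, the right-hand side is also meaningful at $q=0$, where the terms with $n\ge 1$ vanish.) -/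

import Mathlib

/-- The finite `q`-shifted factorial `(x; q)_n = ∏_{k=0}^{n-1} (1 - x q^k)`. -/
noncomputable def qPoch (x q : ℂ) (n : ℕ) : ℂ :=
  ∏ k ∈ Finset.range n, (1 - x * q ^ k)

/-- The infinite `q`-shifted factorial `(x; q)_∞ = ∏_{k=0}^∞ (1 - x q^k)`, for `|q| < 1`. -/
noncomputable def qPochInf (x q : ℂ) : ℂ :=
  ∏' k : ℕ, (1 - x * q ^ k)

/-- The `n`-th term `q^n (-q; q^2)_n / (q; q^2)_{n+1}` of the Eulerian series of `B^{(2)}(q)`. -/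
noncomputable def mockBTerm (q : ℂ) (n : ℕ) : ℂ :=
  q ^ n * qPoch (-q) (q ^ 2) n / qPoch q (q ^ 2) (n + 1)

/-- The second order mock theta function `B^{(2)}(q)`, for `|q| < 1`. -/
noncomputable def mockB (q : ℂ) : ℂ :=
  ∑' n : ℕ, mockBTerm q n

/-- The `n`-th term of the Hecke-type series,
`(-1)^n q^{n^2+2n} / (1 + q^{2n+1}) * ∑_{j=-n}^{n} q^{-j(j+1)/2}`.
The integer division is exact, since `j (j + 1)` is even. -/
noncomputable def heckeBTerm (q : ℂ) (n : ℕ) : ℂ :=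
  (-1) ^ n * q ^ (n ^ 2 + 2 * n) / (1 + q ^ (2 * n + 1)) *
    ∑ j ∈ Finset.Icc (-(n : ℤ)) (n : ℤ), q ^ (-(j * (j + 1) / 2))

/-!
The identity is an instance of Bailey's lemma relative to `a = q`. Put
`a_r = q^{r² + r} ∑_{j=-r}^{r} q^{-j(j+1)/2}` (`heckeSum`), a polynomial in `q`, and consider the
double series

`∑_{r, m ≥ 0} (-1)^r a_r q^{r+m} (-q; q²)_{r+m} / ((q; q)_m (q; q)_{m+2r+1})`,

which converges absolutely, since `|a_r| ≤ 2r + 1`, the products are bounded, and `(q; q)_n` is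
bounded away from `0`. It is summed in two ways.

* Along the diagonals `r + m = n` the inner sum is `q^n (-q; q²)_n / (q; q²)_{n+1}`. This is the
  finite identity `∑_{r ≤ n} (-1)^r a_r / ((q; q)_{n-r} (q; q)_{n+r+1}) = 1 / (q; q²)_{n+1}`
  (`sum_baileyTerm`), the statement that two explicit sequences form a Bailey pair. It follows from
  a first order recurrence in `n`, which holds because the partial sums of the difference of its two
  sides have a closed form (`sum_baileyTerm_sub`).
* For fixed `r` the sum over `m` is a case of the `q`-Gauss sum:
  `∑_m (-q; q²)_{m+r} q^m / ((q; q)_m (q; q)_{m+2r+1}) =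
    (-q; q²)_∞ / ((q; q)_∞² (1 + q^{2r+1}))` (`tsum_gaussTerm`).
  A Wilf–Zeilberger certificate (`gaussCert`) shows that `1 + q^{2r+1}` times the left-hand side does
  not depend on `r`, and letting `r → ∞` reduces its value to `∑_m q^m / (q; q)_m = 1 / (q; q)_∞`.
-/

open Filter Topology

/-! ### Finite and infinite `q`-shifted factorials -/

theorem qPoch_succ (x q : ℂ) (n : ℕ) :
    qPoch x q (n + 1) = qPoch x q n * (1 - x * q ^ n) :=
  Finset.prod_range_succ _ _

theorem qPoch_self_succ (q : ℂ) (n : ℕ) :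
    qPoch q q (n + 1) = qPoch q q n * (1 - q ^ (n + 1)) := by
  rw [qPoch_succ, pow_succ']

@[simp] theorem qPoch_zero (x q : ℂ) : qPoch x q 0 = 1 := Finset.prod_range_zero _

theorem one_sub_pow_succ_ne_zero {q : ℂ} (hq : ‖q‖ < 1) (n : ℕ) : 1 - q ^ (n + 1) ≠ 0 := by
  intro h
  have h1 : ‖q ^ (n + 1)‖ = 1 := by rw [← sub_eq_zero.mp h, norm_one]
  rw [norm_pow] at h1
  exact (pow_lt_one₀ (norm_nonneg q) hq n.succ_ne_zero).ne h1

theorem one_add_pow_succ_ne_zero {q : ℂ} (hq : ‖q‖ < 1) (n : ℕ) : 1 + q ^ (n + 1) ≠ 0 := by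
  intro h
  have h1 : ‖q ^ (n + 1)‖ = 1 := by rw [eq_neg_of_add_eq_zero_right h, norm_neg, norm_one]
  rw [norm_pow] at h1
  exact (pow_lt_one₀ (norm_nonneg q) hq n.succ_ne_zero).ne h1

theorem norm_sq_lt_one {q : ℂ} (hq : ‖q‖ < 1) : ‖q ^ 2‖ < 1 := by
  rw [norm_pow]
  exact pow_lt_one₀ (norm_nonneg q) hq two_ne_zero

theorem qPoch_self_ne_zero {q : ℂ} (hq : ‖q‖ < 1) (n : ℕ) : qPoch q q n ≠ 0 := by
  refine Finset.prod_ne_zero_iff.mpr fun k _ => ?_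
  rw [← pow_succ']
  exact one_sub_pow_succ_ne_zero hq k

theorem qPoch_sq_ne_zero {q : ℂ} (hq : ‖q‖ < 1) (n : ℕ) : qPoch q (q ^ 2) n ≠ 0 := by
  refine Finset.prod_ne_zero_iff.mpr fun k _ => ?_
  rw [← pow_mul, ← pow_succ']
  exact one_sub_pow_succ_ne_zero hq _

theorem summable_norm_mul_pow {x q : ℂ} (hq : ‖q‖ < 1) : Summable fun k : ℕ => ‖-(x * q ^ k)‖ := by
  simp only [norm_neg, norm_mul, norm_pow]
  exact (summable_geometric_of_lt_one (norm_nonneg q) hq).mul_left _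

theorem multipliable_qPoch (x : ℂ) {q : ℂ} (hq : ‖q‖ < 1) :
    Multipliable fun k : ℕ => 1 - x * q ^ k := by
  simpa only [sub_eq_add_neg] using
    multipliable_one_add_of_summable (summable_norm_mul_pow (x := x) hq)

theorem tendsto_qPoch (x : ℂ) {q : ℂ} (hq : ‖q‖ < 1) :
    Tendsto (qPoch x q) atTop (𝓝 (qPochInf x q)) :=
  (multipliable_qPoch x hq).hasProd.tendsto_prod_nat

theorem qPochInf_self_ne_zero {q : ℂ} (hq : ‖q‖ < 1) : qPochInf q q ≠ 0 := by
  have h := tprod_one_add_ne_zero_of_summable (f := fun k : ℕ => -(q * q ^ k))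
    (fun k => by
      rw [← sub_eq_add_neg, ← pow_succ']
      exact one_sub_pow_succ_ne_zero hq k) (summable_norm_mul_pow hq)
  simpa only [qPochInf, sub_eq_add_neg] using h

theorem exists_norm_qPoch_le (x : ℂ) {q : ℂ} (hq : ‖q‖ < 1) : ∃ C : ℝ, ∀ n, ‖qPoch x q n‖ ≤ C := by
  obtain ⟨C, hC⟩ := (Metric.isBounded_range_of_tendsto _ (tendsto_qPoch x hq)).exists_norm_le
  exact ⟨C, fun n => hC _ ⟨n, rfl⟩⟩

theorem exists_norm_inv_qPoch_le {q : ℂ} (hq : ‖q‖ < 1) :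
    ∃ C : ℝ, ∀ n, ‖(qPoch q q n)⁻¹‖ ≤ C := by
  obtain ⟨C, hC⟩ := (Metric.isBounded_range_of_tendsto _
    ((tendsto_qPoch q hq).inv₀ (qPochInf_self_ne_zero hq))).exists_norm_le
  exact ⟨C, fun n => hC _ ⟨n, rfl⟩⟩

/-! ### The Hecke-type coefficients -/

/-- The polynomial `q^{n² + n} ∑_{j=-n}^{n} q^{-j(j+1)/2}` in `q`, defined by the recurrence that
the terms `j = ±(n + 1)` produce, so that it makes sense at `q = 0` as well. For `q ≠ 0` the closed
form is `heckeSum_eq`. -/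
noncomputable def heckeSum (q : ℂ) : ℕ → ℂ
  | 0 => 1
  | n + 1 => q ^ (2 * n + 2) * heckeSum q n + q ^ (n + 2).choose 2 * (1 + q ^ (n + 1))

theorem choose_succ_two (n : ℕ) : (n + 1).choose 2 = n.choose 2 + n := by
  rw [Nat.choose_succ_succ', Nat.choose_one_right, add_comm]

theorem two_mul_choose_two (n : ℕ) : 2 * (n + 1).choose 2 = n * (n + 1) := by
  induction n with
  | zero => rfl
  | succ n ih => rw [choose_succ_two, mul_add, ih]; ring

theorem norm_heckeSum_le {q : ℂ} (hq : ‖q‖ < 1) (n : ℕ) : ‖heckeSum q n‖ ≤ 2 * n + 1 := by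
  have hp (k : ℕ) : ‖q ^ k‖ ≤ 1 := by
    rw [norm_pow]; exact pow_le_one₀ (norm_nonneg q) hq.le
  induction n with
  | zero => simp [heckeSum]
  | succ n ih =>
    rw [heckeSum]
    calc _ ≤ ‖q ^ (2 * n + 2)‖ * ‖heckeSum q n‖
          + ‖q ^ (n + 2).choose 2‖ * (‖(1 : ℂ)‖ + ‖q ^ (n + 1)‖) := by
          refine (norm_add_le _ _).trans ?_
          rw [norm_mul, norm_mul]
          gcongr
          exact norm_add_le _ _
      _ ≤ 1 * (2 * n + 1) + 1 * (1 + 1) := by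
          rw [norm_one]
          gcongr <;> apply hp
      _ = _ := by push_cast; ring

theorem heckeSum_eq {q : ℂ} (hq : q ≠ 0) (n : ℕ) :
    q ^ (n ^ 2 + n) * ∑ j ∈ Finset.Icc (-(n : ℤ)) (n : ℤ), q ^ (-(j * (j + 1) / 2)) =
      heckeSum q n := by
  induction n with
  | zero => simp [heckeSum]
  | succ n ih =>
    have hI : Finset.Icc (-((n + 1 : ℕ) : ℤ)) ((n + 1 : ℕ) : ℤ) =
        insert (-(n + 1 : ℤ)) (insert (n + 1 : ℤ) (Finset.Icc (-(n : ℤ)) (n : ℤ))) := by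
      ext j
      simp only [Finset.mem_Icc, Finset.mem_insert]
      push_cast
      omega
    have hc := two_mul_choose_two n
    have hc' := choose_succ_two (n + 1)
    have h1 : -(-(n + 1 : ℤ) * (-(n + 1 : ℤ) + 1) / 2) = -((n + 1).choose 2 : ℤ) := by
      zify at hc
      rw [show -(n + 1 : ℤ) * (-(n + 1 : ℤ) + 1) = 2 * (n + 1).choose 2 by rw [hc]; ring]
      omega
    have h2 : -((n + 1 : ℤ) * ((n + 1 : ℤ) + 1) / 2) = -((n + 2).choose 2 : ℤ) := by
      have h : 2 * (n + 2).choose 2 = _ := two_mul_choose_two (n + 1)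
      zify at h
      rw [← h]
      omega
    -- The exponents contributed by `j = -(n + 1)` and `j = n + 1`, respectively.
    have e1 : (n + 1) ^ 2 + (n + 1) = (n + 1).choose 2 + (n + 2).choose 2 + (n + 1) := by
      have h := two_mul_choose_two (n + 1)
      rw [hc'] at h ⊢
      nlinarith
    have e2 : (n + 1) ^ 2 + (n + 1) = (n + 2).choose 2 + (n + 2).choose 2 := by
      have h := two_mul_choose_two (n + 1)
      nlinarith
    rw [hI, Finset.sum_insert, Finset.sum_insert, h1, h2, heckeSum, ← ih, mul_add, mul_add,
      zpow_neg, zpow_neg, zpow_natCast, zpow_natCast]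
    · rw [show (q ^ ((n + 1) ^ 2 + (n + 1))) * (q ^ (n + 1).choose 2)⁻¹
          = q ^ (n + 2).choose 2 * q ^ (n + 1) by
            rw [e1, pow_add, pow_add]; field_simp,
        show (q ^ ((n + 1) ^ 2 + (n + 1))) * (q ^ (n + 2).choose 2)⁻¹ = q ^ (n + 2).choose 2 by
            rw [e2, pow_add]; field_simp]
      ring
    · simp
    · simp only [Finset.mem_Icc, Finset.mem_insert]
      omega

/-- This holds for `q = 0` too: for `n ≥ 1` both sides vanish there. -/
theorem heckeBTerm_eq (q : ℂ) (n : ℕ) :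
    heckeBTerm q n = (-1) ^ n * heckeSum q n * (q ^ n / (1 + q ^ (2 * n + 1))) := by
  rw [heckeBTerm]
  rcases eq_or_ne q 0 with rfl | hq
  · cases n <;> simp [heckeSum]
  · rw [← heckeSum_eq hq, show n ^ 2 + 2 * n = n ^ 2 + n + n by ring, pow_add _ (n ^ 2 + n)]
    ring


/-! ### The Bailey pair -/

/-- The `r`-th summand `(-1)^r a_r / ((q; q)_{n-r} (q; q)_{n+r+1})`, with `a_r = heckeSum q r`, of
the `n`-th Bailey pair identity. It is meant for `r ≤ n` only, because `n - r` is truncated. -/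
noncomputable def baileyTerm (q : ℂ) (n r : ℕ) : ℂ :=
  (-1) ^ r * heckeSum q r / (qPoch q q (n - r) * qPoch q q (n + r + 1))

/-- Closed form of the partial sums of the difference of the two sides of the recurrence
`sum_baileyTerm_succ`. The first summand on the right comes from summation by parts against the
inner sum in `heckeSum`; the second from the telescoping of
`(-1)^r q^{r(r-1)/2} (1 + q^r) / ((q; q)_{n+1-r} (q; q)_{n+1+r})`, which is what remains. -/
theorem sum_baileyTerm_sub {q : ℂ} (hq : ‖q‖ < 1) (n R : ℕ) (hR : R ≤ n) :
    ∑ r ∈ Finset.range (R + 1),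
        ((1 - q ^ (2 * n + 3)) * baileyTerm q (n + 1) r - baileyTerm q n r) =
      (-1) ^ R * q ^ (n + 1) / qPoch q q (n - R) *
        (q ^ (R + 1) * heckeSum q R / qPoch q q (n + R + 2) +
          q ^ (R + 1).choose 2 / (qPoch q q (n + R + 1) * (1 - q ^ (n + 1)))) := by
  have hP := qPoch_self_ne_zero hq
  have hs := one_sub_pow_succ_ne_zero hq
  induction R with
  | zero =>
    have h1 := hP n
    have h2 := hP (n + 1)
    have h3 := hs n
    have h4 := hs (n + 1)
    simp only [baileyTerm, heckeSum, Finset.sum_range_one, zero_add, Nat.sub_zero, add_zero,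
      qPoch_self_succ q (n + 1), qPoch_self_succ q n, Nat.choose_succ_self, pow_zero, pow_one]
    field_simp
    ring
  | succ R ih =>
    obtain ⟨k, rfl⟩ := Nat.exists_eq_add_of_le' hR
    have h0 := hP k
    have h1 := hP (k + (R + 1) + R + 1)
    have h2 := hs k
    have h3 := hs (k + (R + 1))
    have h4 := hs (k + (R + 1) + R + 1)
    have h5 := hs (k + (R + 1) + R + 1 + 1)
    rw [Finset.sum_range_succ, ih (by omega)]
    simp only [baileyTerm, show k + (R + 1) - R = k + 1 by omega,
      show k + (R + 1) + 1 - (R + 1) = k + 1 by omega, show k + (R + 1) - (R + 1) = k by omega,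
      show k + (R + 1) + 1 + (R + 1) + 1 = k + (R + 1) + R + 1 + 1 + 1 by ring,
      show k + (R + 1) + (R + 1) + 2 = k + (R + 1) + R + 1 + 1 + 1 by ring,
      show k + (R + 1) + (R + 1) + 1 = k + (R + 1) + R + 1 + 1 by ring,
      show k + (R + 1) + R + 2 = k + (R + 1) + R + 1 + 1 by ring,
      heckeSum, qPoch_self_succ q k, qPoch_self_succ q (k + (R + 1) + R + 1),
      qPoch_self_succ q (k + (R + 1) + R + 1 + 1), choose_succ_two (R + 1)]
    field_simp
    ring

theorem sum_baileyTerm_succ {q : ℂ} (hq : ‖q‖ < 1) (n : ℕ) :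
    (1 - q ^ (2 * n + 3)) * ∑ r ∈ Finset.range (n + 2), baileyTerm q (n + 1) r =
      ∑ r ∈ Finset.range (n + 1), baileyTerm q n r := by
  have h := sum_baileyTerm_sub hq n n le_rfl
  rw [Finset.sum_sub_distrib, ← Finset.mul_sum, sub_eq_iff_eq_add'] at h
  -- The term `r = n + 1`, present on the left only, cancels the closed form of the partial sum.
  rw [Finset.sum_range_succ, mul_add, h, add_assoc, add_eq_left]
  have h1 := qPoch_self_ne_zero hq (n + n + 1)
  have h3 := one_sub_pow_succ_ne_zero hq n
  have h4 := one_sub_pow_succ_ne_zero hq (n + n + 1)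
  have h5 := one_sub_pow_succ_ne_zero hq (n + n + 1 + 1)
  simp only [baileyTerm, Nat.sub_self, show n + 1 + (n + 1) + 1 = n + n + 1 + 1 + 1 by ring,
    show n + n + 2 = n + n + 1 + 1 by ring, heckeSum, qPoch_zero,
    qPoch_self_succ q (n + n + 1), qPoch_self_succ q (n + n + 1 + 1), choose_succ_two (n + 1)]
  field_simp
  ring

/-- The sequences `(-1)^r a_r` and `1 / (q; q²)_{n+1}` form, up to normalization, a Bailey pair
relative to `q`. -/
theorem sum_baileyTerm {q : ℂ} (hq : ‖q‖ < 1) (n : ℕ) :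
    ∑ r ∈ Finset.range (n + 1), baileyTerm q n r = (qPoch q (q ^ 2) (n + 1))⁻¹ := by
  induction n with
  | zero => simp [baileyTerm, heckeSum, qPoch]
  | succ n ih =>
    have h := one_sub_pow_succ_ne_zero hq (2 * n + 2)
    rw [qPoch_succ, mul_inv, ← ih, ← sum_baileyTerm_succ hq n, ← pow_mul, ← pow_succ',
      show 2 * (n + 1) + 1 = 2 * n + 3 by ring]
    field_simp

/-! ### A case of the `q`-Gauss sum -/

/-- The summand `(-q; q²)_{m+r} q^m / ((q; q)_m (q; q)_{m+2r+1})`. Up to a factor free of `m` it is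
the `m`-th term of `₂φ₁(i q^{r+1/2}, -i q^{r+1/2}; q^{2r+2}; q, q)`. -/
noncomputable def gaussTerm (q : ℂ) (r m : ℕ) : ℂ :=
  qPoch (-q) (q ^ 2) (m + r) * q ^ m / (qPoch q q m * qPoch q q (m + 2 * r + 1))

/-- The Wilf–Zeilberger mate of `(1 + q^{2r+1}) * gaussTerm q r m`; see `gaussTerm_succ_sub`. -/
noncomputable def gaussCert (q : ℂ) (r m : ℕ) : ℂ :=
  qPoch (-q) (q ^ 2) (m + r) * (1 - q ^ m) * q ^ (m + 2 * r + 1) *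
      (1 + q + (1 - q ^ (2 * r + 2)) * q ^ m) / (qPoch q q m * qPoch q q (m + 2 * r + 2))

theorem gaussTerm_succ_sub {q : ℂ} (hq : ‖q‖ < 1) (r m : ℕ) :
    (1 + q ^ (2 * r + 3)) * gaussTerm q (r + 1) m - (1 + q ^ (2 * r + 1)) * gaussTerm q r m =
      gaussCert q r (m + 1) - gaussCert q r m := by
  have h0 := qPoch_self_ne_zero hq m
  have h1 := qPoch_self_ne_zero hq (m + 2 * r + 1)
  have h2 := one_sub_pow_succ_ne_zero hq m
  have h3 := one_sub_pow_succ_ne_zero hq (m + 2 * r + 1)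
  have h4 := one_sub_pow_succ_ne_zero hq (m + 2 * r + 1 + 1)
  simp only [gaussTerm, gaussCert, show m + 2 * (r + 1) + 1 = m + 2 * r + 1 + 1 + 1 by ring,
    show m + 1 + 2 * r + 2 = m + 2 * r + 1 + 1 + 1 by ring, show m + (r + 1) = m + r + 1 by ring,
    show m + 1 + r = m + r + 1 by ring, show m + 2 * r + 2 = m + 2 * r + 1 + 1 by ring,
    qPoch_self_succ q m, qPoch_self_succ q (m + 2 * r + 1),
    qPoch_self_succ q (m + 2 * r + 1 + 1), qPoch_succ (-q) (q ^ 2) (m + r)]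
  field_simp
  ring

theorem exists_norm_gaussTerm_le {q : ℂ} (hq : ‖q‖ < 1) :
    ∃ C : ℝ, 0 ≤ C ∧ ∀ r m, ‖gaussTerm q r m‖ ≤ C * ‖q‖ ^ m := by
  have hq2 := norm_sq_lt_one hq
  obtain ⟨A, hA⟩ := exists_norm_qPoch_le (-q) hq2
  obtain ⟨B, hB⟩ := exists_norm_inv_qPoch_le hq
  have hA0 : 0 ≤ A := (norm_nonneg _).trans (hA 0)
  have hB0 : 0 ≤ B := (norm_nonneg _).trans (hB 0)
  refine ⟨A * (B * B), by positivity, fun r m => ?_⟩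
  rw [gaussTerm, div_eq_mul_inv, mul_inv, norm_mul, norm_mul, norm_mul, norm_pow,
    mul_right_comm]
  gcongr <;> apply_rules

theorem summable_gaussTerm {q : ℂ} (hq : ‖q‖ < 1) (r : ℕ) : Summable (gaussTerm q r) := by
  obtain ⟨C, -, hC⟩ := exists_norm_gaussTerm_le hq
  exact .of_norm_bounded ((summable_geometric_of_lt_one (norm_nonneg q) hq).mul_left C) (hC r)

theorem tendsto_gaussCert {q : ℂ} (hq : ‖q‖ < 1) (r : ℕ) :
    Tendsto (gaussCert q r) atTop (𝓝 0) := by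
  have hq2 := norm_sq_lt_one hq
  have hp := tendsto_pow_atTop_nhds_zero_of_norm_lt_one hq
  have hP := tendsto_qPoch q hq
  have h0 := qPochInf_self_ne_zero hq
  have hadd (k : ℕ) : Tendsto (fun m : ℕ => m + k) atTop atTop := tendsto_add_atTop_nat k
  have h := (((((tendsto_qPoch (-q) hq2).comp (hadd r)).mul (hp.const_sub 1)).mul
    (hp.comp (hadd (2 * r + 1)))).mul ((hp.const_mul (1 - q ^ (2 * r + 2))).const_add (1 + q))).div
    (hP.mul (hP.comp (hadd (2 * r + 2)))) (mul_ne_zero h0 h0)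
  rw [sub_zero, mul_one, mul_zero, zero_mul, zero_div] at h
  exact h

theorem tsum_gaussTerm_succ {q : ℂ} (hq : ‖q‖ < 1) (r : ℕ) :
    (1 + q ^ (2 * r + 3)) * ∑' m, gaussTerm q (r + 1) m =
      (1 + q ^ (2 * r + 1)) * ∑' m, gaussTerm q r m := by
  rw [← sub_eq_zero, ← tsum_mul_left, ← tsum_mul_left, ← Summable.tsum_sub
    ((summable_gaussTerm hq _).mul_left _) ((summable_gaussTerm hq _).mul_left _)]
  have hs := ((summable_gaussTerm hq (r + 1)).mul_left (1 + q ^ (2 * r + 3))).sub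
    ((summable_gaussTerm hq r).mul_left (1 + q ^ (2 * r + 1)))
  refine tendsto_nhds_unique hs.hasSum.tendsto_sum_nat ?_
  have h0 : gaussCert q r 0 = 0 := by simp [gaussCert]
  simp_rw [gaussTerm_succ_sub hq, Finset.sum_range_sub, h0, sub_zero]
  exact tendsto_gaussCert hq r

theorem tsum_pow_div_qPoch {q : ℂ} (hq : ‖q‖ < 1) :
    ∑' m, q ^ m / qPoch q q m = (qPochInf q q)⁻¹ := by
  -- The partial sums telescope.
  have hsum (n : ℕ) : ∑ m ∈ Finset.range (n + 1), q ^ m / qPoch q q m = (qPoch q q n)⁻¹ := by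
    induction n with
    | zero => simp
    | succ n ih =>
      have h1 := qPoch_self_ne_zero hq n
      have h2 := one_sub_pow_succ_ne_zero hq n
      rw [Finset.sum_range_succ, ih, qPoch_self_succ]
      field_simp
      ring
  obtain ⟨B, hB⟩ := exists_norm_inv_qPoch_le hq
  have hs : Summable fun m => q ^ m / qPoch q q m := by
    refine .of_norm_bounded ((summable_geometric_of_lt_one (norm_nonneg q) hq).mul_right B)
      fun m => ?_
    rw [div_eq_mul_inv, norm_mul, norm_pow]
    gcongr
    exact hB m
  refine tendsto_nhds_unique (hs.hasSum.tendsto_sum_nat.comp (tendsto_add_atTop_nat 1)) ?_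
  exact ((tendsto_qPoch q hq).inv₀ (qPochInf_self_ne_zero hq)).congr fun n => (hsum n).symm

theorem tendsto_tsum_gaussTerm {q : ℂ} (hq : ‖q‖ < 1) :
    Tendsto (fun r => ∑' m, gaussTerm q r m) atTop
      (𝓝 (qPochInf (-q) (q ^ 2) / qPochInf q q ^ 2)) := by
  have hq2 := norm_sq_lt_one hq
  obtain ⟨C, -, hC⟩ := exists_norm_gaussTerm_le hq
  have h0 := qPochInf_self_ne_zero hq
  have hlim : qPochInf (-q) (q ^ 2) / qPochInf q q ^ 2 =
      ∑' m, qPochInf (-q) (q ^ 2) / qPochInf q q * (q ^ m / qPoch q q m) := by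
    rw [tsum_mul_left, tsum_pow_div_qPoch hq]
    field_simp
  rw [hlim]
  refine tendsto_tsum_of_dominated_convergence
    ((summable_geometric_of_lt_one (norm_nonneg q) hq).mul_left C) (fun m => ?_)
    (.of_forall hC)
  have h1 : Tendsto (fun r : ℕ => m + r) atTop atTop :=
    tendsto_atTop_mono (fun r => Nat.le_add_left r m) tendsto_id
  have h2 : Tendsto (fun r : ℕ => m + 2 * r + 1) atTop atTop :=
    tendsto_atTop_mono (fun r => by simp only [id]; omega) tendsto_id
  refine (((((tendsto_qPoch (-q) hq2).comp h1)).div ((tendsto_qPoch q hq).comp h2) h0).mul_const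
    (q ^ m / qPoch q q m)).congr fun r => ?_
  simp only [Function.comp_apply, Pi.div_apply, gaussTerm]
  ring

theorem tsum_gaussTerm {q : ℂ} (hq : ‖q‖ < 1) (r : ℕ) :
    ∑' m, gaussTerm q r m =
      qPochInf (-q) (q ^ 2) / qPochInf q q ^ 2 / (1 + q ^ (2 * r + 1)) := by
  have hconst (r : ℕ) : (1 + q ^ (2 * r + 1)) * ∑' m, gaussTerm q r m =
      (1 + q ^ (2 * 0 + 1)) * ∑' m, gaussTerm q 0 m := by
    induction r with
    | zero => rfl
    | succ r ih => rw [← ih, ← tsum_gaussTerm_succ hq r]; rfl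
  have h1 : Tendsto (fun r : ℕ => 2 * r + 1) atTop atTop :=
    tendsto_atTop_mono (fun r => by simp only [id]; omega) tendsto_id
  have hlim := (((tendsto_pow_atTop_nhds_zero_of_norm_lt_one hq).comp h1).const_add 1).mul
    (tendsto_tsum_gaussTerm hq)
  rw [add_zero, one_mul] at hlim
  rw [eq_div_iff (one_add_pow_succ_ne_zero hq _), mul_comm, hconst r]
  exact tendsto_nhds_unique tendsto_const_nhds (hlim.congr hconst)

/-! ### The double series -/

/-- The term of the double series at `p = (r, m)`; its sums over the diagonals `r + m = n` are the
terms of `mockB`, its sums over `m` those of the Hecke-type series times the infinite products. -/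
noncomputable def doubleTerm (q : ℂ) (p : ℕ × ℕ) : ℂ :=
  (-1) ^ p.1 * heckeSum q p.1 * q ^ p.1 * gaussTerm q p.1 p.2

theorem summable_natCast_mul_pow {q : ℂ} (hq : ‖q‖ < 1) :
    Summable fun n : ℕ => (2 * n + 1 : ℝ) * ‖q‖ ^ n := by
  have h1 := summable_pow_mul_geometric_of_norm_lt_one (R := ℝ) 1 (r := ‖q‖) (by simpa using hq)
  have h2 := summable_geometric_of_lt_one (norm_nonneg q) hq
  refine ((h1.mul_left 2).add h2).congr fun n => ?_
  ring

theorem norm_neg_one_pow_mul_heckeSum_mul_pow_le {q : ℂ} (hq : ‖q‖ < 1) (n : ℕ) :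
    ‖(-1) ^ n * heckeSum q n * q ^ n‖ ≤ (2 * n + 1) * ‖q‖ ^ n := by
  rw [norm_mul, norm_mul, norm_pow, norm_neg, norm_one, one_pow, one_mul, norm_pow]
  gcongr
  exact norm_heckeSum_le hq n

theorem summable_doubleTerm {q : ℂ} (hq : ‖q‖ < 1) : Summable (doubleTerm q) := by
  obtain ⟨C, hC0, hC⟩ := exists_norm_gaussTerm_le hq
  have h2 := (summable_geometric_of_lt_one (norm_nonneg q) hq).mul_left C
  refine .of_norm_bounded ((summable_natCast_mul_pow hq).mul_of_nonneg h2
    (fun n => by positivity) (fun n => by positivity)) fun p => ?_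
  rw [doubleTerm, norm_mul]
  exact mul_le_mul (norm_neg_one_pow_mul_heckeSum_mul_pow_le hq _) (hC _ _) (norm_nonneg _)
    (by positivity)

theorem tsum_doubleTerm_right {q : ℂ} (hq : ‖q‖ < 1) (r : ℕ) :
    ∑' m, doubleTerm q (r, m) =
      qPochInf (-q) (q ^ 2) / qPochInf q q ^ 2 * heckeBTerm q r := by
  simp only [doubleTerm, tsum_mul_left, tsum_gaussTerm hq, heckeBTerm_eq]
  ring

theorem sum_antidiagonal_doubleTerm {q : ℂ} (hq : ‖q‖ < 1) (n : ℕ) :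
    ∑ p ∈ Finset.HasAntidiagonal.antidiagonal n, doubleTerm q p = mockBTerm q n := by
  rw [mockBTerm, div_eq_mul_inv, ← sum_baileyTerm hq, Finset.mul_sum,
    Finset.Nat.sum_antidiagonal_eq_sum_range_succ_mk]
  refine Finset.sum_congr rfl fun r hr => ?_
  obtain ⟨k, rfl⟩ := Nat.exists_eq_add_of_le' (Nat.lt_succ_iff.mp (Finset.mem_range.mp hr))
  simp only [doubleTerm, gaussTerm, baileyTerm, Nat.add_sub_cancel,
    show k + 2 * r + 1 = k + r + r + 1 by ring]
  ring

theorem hasSum_mockBTerm {q : ℂ} (hq : ‖q‖ < 1) :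
    HasSum (mockBTerm q) (∑' p, doubleTerm q p) := by
  have h := (Finset.HasAntidiagonal.sigmaAntidiagonalEquivProd (A := ℕ)).hasSum_iff.mpr
    (summable_doubleTerm hq).hasSum
  refine h.sigma fun n => ?_
  rw [← sum_antidiagonal_doubleTerm hq]
  exact Finset.hasSum (Finset.HasAntidiagonal.antidiagonal n) (doubleTerm q)

theorem summable_heckeBTerm {q : ℂ} (hq : ‖q‖ < 1) : Summable (heckeBTerm q) := by
  refine .of_norm_bounded ((summable_natCast_mul_pow hq).mul_right (1 - ‖q‖)⁻¹) fun n => ?_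
  have h1 : 1 - ‖q‖ ≤ ‖1 + q ^ (2 * n + 1)‖ := by
    have h := norm_sub_norm_le (1 : ℂ) (-q ^ (2 * n + 1))
    rw [norm_one, norm_neg, norm_pow, sub_neg_eq_add] at h
    have h' := pow_le_of_le_one (norm_nonneg q) hq.le (2 * n).succ_ne_zero
    rw [Nat.succ_eq_add_one] at h'
    linarith
  rw [heckeBTerm_eq, ← mul_div_assoc, norm_div, div_eq_mul_inv]
  have h0 : 0 < 1 - ‖q‖ := sub_pos.mpr hq
  gcongr
  exact norm_neg_one_pow_mul_heckeSum_mul_pow_le hq n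

theorem mainTheorem6 (q : ℂ) (hq : ‖q‖ < 1) :
    Summable (mockBTerm q) ∧
    Summable (heckeBTerm q) ∧
    Multipliable (fun k : ℕ => 1 - (-q) * (q ^ 2) ^ k) ∧
    Multipliable (fun k : ℕ => 1 - q * q ^ k) ∧
    qPochInf q q ≠ 0 ∧
    mockB q = qPochInf (-q) (q ^ 2) / qPochInf q q ^ 2 * ∑' n : ℕ, heckeBTerm q n := by
  have hq2 := norm_sq_lt_one hq
  refine ⟨(hasSum_mockBTerm hq).summable, summable_heckeBTerm hq, multipliable_qPoch _ hq2,
    multipliable_qPoch _ hq, qPochInf_self_ne_zero hq, ?_⟩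
  rw [mockB, (hasSum_mockBTerm hq).tsum_eq, (summable_doubleTerm hq).tsum_prod, ← tsum_mul_left]
  exact tsum_congr (tsum_doubleTerm_right hq)
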